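/- There is an absolute constant $A>0$ such that the following holds. Let $d\ge 0$, $k\ge 2$ and $\ell\ge 1$ be integers and let $X\subset\mathbb{R}^d$ be a finite nonempty set. For finite $C,K\subset\mathbb{R}^d$ with $C\neq\emptyset$ put $\phi(x,C)=\min_{c\in C}\|x-c\|_2^2$ and $\phi(K,C)=\sum_{x\in K}\phi(x,C)$, and let $\phi^*(K)=\phi(K,\{\mu(K)\})$, where $\mu(K)$ is the center of mass of $K$. Run greedy $k$-means++ on $(X,k,\ell)$. Start with $C_0=\emptyset$. In step $i+1$ (for $0\le i\le k-1$) sample candidates $c_{i+1}^1,\dots,c_{i+1}^\ell\in X$ independently: uniformly from $X$ if $i=0$, and $x\in X$ with probability $\phi(x,C_i)/\phi(X,C_i)$ if $i\ge 1$ (uniformly if $\phi(X,C_i)=0$; such steps do not contribute to the count below). Let $c_{i+1}$ be a candidate $c$ that minimizes $\phi(X,C_i\cup\{c\})$ among $c_{i+1}^1,\dots,c_{i+1}^\ell$, with ties broken by an arbitrary rule that may depend on all candidates sampled so far, and set $C_{i+1}=C_i\cup\{c_{i+1}\}$. Let $K$ be a cluster of an optimal $k$-means solution $C^*$ of $X$;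 that is, $C^*\subset\mathbb{R}^d$ with $|C^*|=k$ minimizes $\phi(X,\cdot)$ among the sets of $k$ centers, every point of $X$ is assigned to a closest center in $C^*$ (ties broken arbitrarily), and $K$ is the set of points assigned to one fixed center. Call $K$ covered with respect to $C_i$ if $K\cap C_i\ne\emptyset$, and solved with respect to $C_i$ if $C_i\neq\emptyset$ and $\phi(K,C_i)\le 10^5\,\phi^*(K)$. Let $\mathrm{HIT}(K)$ be the number of pairs $(i,j)$ with $0\le i\le k-1$ and $1\le j\le\ell$ such that $c_{i+1}^j\in K$ and $K$ is neither covered nor solved with respect to $C_i$. Then $$\mathbb{E}[\mathrm{HIT}(K)]\le A\,\ell^2\log^2 k .$$ -/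

import Mathlib

namespace GreedyKMeans

noncomputable section

open scoped ENNReal Classical

/-- Points of `ℝ^d`, with the Euclidean distance. -/
abbrev Pt (d : ℕ) := EuclideanSpace ℝ (Fin d)

/-- The cost `φ(x, C) = min_{c ∈ C} ‖x - c‖²` of one point, for a nonempty finite set `C`
of centers. (Every use below treats `C = ∅` separately.) -/
def pointCost {d : ℕ} (x : Pt d) (C : Finset (Pt d)) : ℝ :=
  Metric.infDist x (C : Set (Pt d)) ^ 2

/-- The cost `φ(K, C) = ∑_{x ∈ K} φ(x, C)`. -/
def cost {d : ℕ} (K C : Finset (Pt d)) : ℝ := ∑ x ∈ K, pointCost x C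

/-- The center of mass `μ(K)`. -/
def centroid {d : ℕ} (K : Finset (Pt d)) : Pt d := (K.card : ℝ)⁻¹ • ∑ x ∈ K, x

/-- `φ*(K) = φ(K, μ(K))`. -/
def optCost {d : ℕ} (K : Finset (Pt d)) : ℝ := cost K {centroid K}

/-- `C` is an optimal solution of the `k`-means problem on `X`. -/
def IsOptimalSolution {d : ℕ} (X : Finset (Pt d)) (k : ℕ) (C : Finset (Pt d)) : Prop :=
  C.card = k ∧ ∀ C' : Finset (Pt d), C'.card = k → cost X C ≤ cost X C'

/-- `K` is a cluster of some optimal solution: every point of `X` is assigned to a closest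
center (ties being broken by the assignment `a`), and `K` is the set of points assigned to one
of the centers. -/
def IsOptimalCluster {d : ℕ} (X : Finset (Pt d)) (k : ℕ) (K : Finset (Pt d)) : Prop :=
  ∃ C : Finset (Pt d), IsOptimalSolution X k C ∧
    ∃ a : Pt d → Pt d, (∀ x ∈ X, a x ∈ C ∧ ∀ c ∈ C, dist x (a x) ≤ dist x c) ∧
      ∃ c ∈ C, K = X.filter (fun x => a x = c)

/-- `K` is covered with respect to the set of centers `C`. -/
def IsCovered {d : ℕ} (K C : Finset (Pt d)) : Prop := (K ∩ C).Nonempty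

/-- `K` is solved with respect to the set of centers `C`. Before any center is chosen the cost
is infinite, so that nothing is solved with respect to `∅`. -/
def IsSolved {d : ℕ} (K C : Finset (Pt d)) : Prop :=
  C.Nonempty ∧ cost K C ≤ 10 ^ 5 * optCost K

theorem cost_nonneg {d : ℕ} (K C : Finset (Pt d)) : 0 ≤ cost K C :=
  Finset.sum_nonneg fun _ _ => sq_nonneg _

theorem pointCost_nonneg {d : ℕ} (x : Pt d) (C : Finset (Pt d)) : 0 ≤ pointCost x C :=
  sq_nonneg _

theorem sum_pointCost_div {d : ℕ} (X C : Finset (Pt d)) (h : cost X C ≠ 0) :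
    ∑ x : X, ENNReal.ofReal (pointCost (x : Pt d) C / cost X C) = 1 := by
  rw [← ENNReal.ofReal_sum_of_nonneg
      (fun x _ => div_nonneg (pointCost_nonneg _ C) (cost_nonneg X C)),
    ← Finset.sum_div, Finset.sum_coe_sort X (fun x => pointCost x C)]
  change ENNReal.ofReal (cost X C / cost X C) = 1
  rw [div_self h, ENNReal.ofReal_one]

/-- The law of one candidate center when `C` is the current set of centers: uniform on `X` in
the first step (`C = ∅`), and `x` with probability `φ(x, C) / φ(X, C)` afterwards. If
`φ(X, C) = 0` this quotient is undefined and the uniform law is used; every cluster is solved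
by then. -/
def sampleLaw {d : ℕ} (X : Finset (Pt d)) [Nonempty X] (C : Finset (Pt d)) : PMF X :=
  if h : C.Nonempty ∧ cost X C ≠ 0 then
    PMF.ofFintype (fun x : X => ENNReal.ofReal (pointCost (x : Pt d) C / cost X C))
      (sum_pointCost_div X C h.2)
  else PMF.uniformOfFintype X

theorem sum_prod_pmf {α : Type*} [Fintype α] (l : ℕ) (p : PMF α) :
    ∑ c : Fin l → α, ∏ j, p (c j) = 1 := by
  have h : ∑ x, p x = 1 := by rw [← tsum_fintype (L := .unconditional _)]; exact p.tsum_coe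
  rw [← Fintype.piFinset_univ, ← Finset.prod_univ_sum]
  simp [h]

/-- The law of `l` independent samples from `p`. -/
def iidLaw {α : Type*} [Fintype α] (l : ℕ) (p : PMF α) : PMF (Fin l → α) :=
  PMF.ofFintype (fun c => ∏ j, p (c j)) (sum_prod_pmf l p)

/-- The candidates sampled in all the steps so far, the most recent step first: each entry is
the tuple `(c_i^1, …, c_i^l)` of one step. -/
abbrev History {d : ℕ} (X : Finset (Pt d)) (l : ℕ) := List (Fin l → X)

/-- A selection rule: from the past and the present candidates, the index of the candidate that
becomes the next center. -/
abbrev Rule {d : ℕ} (X : Finset (Pt d)) (l : ℕ) := History X l → (Fin l → X) → Fin l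

/-- The set `C_i` of centers chosen in the first `i` steps. -/
def centers {d : ℕ} {X : Finset (Pt d)} {l : ℕ} (r : Rule X l) : History X l → Finset (Pt d)
  | [] => ∅
  | c :: h => insert (c (r h c) : Pt d) (centers r h)

/-- The rule always selects a candidate that minimizes the new cost `φ(X, C_i ∪ {c})`. Ties may
be broken in any way. -/
def IsGreedy {d : ℕ} {X : Finset (Pt d)} {l : ℕ} (r : Rule X l) : Prop :=
  ∀ (h : History X l) (c : Fin l → X) (j : Fin l),
    cost X (insert (c (r h c) : Pt d) (centers r h)) ≤ cost X (insert (c j : Pt d) (centers r h))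

/-- The law of the candidates of the first `n` steps of the algorithm that uses the rule `r`. -/
def runLaw {d : ℕ} {X : Finset (Pt d)} [Nonempty X] {l : ℕ} (r : Rule X l) :
    ℕ → PMF (History X l)
  | 0 => PMF.pure []
  | n + 1 => (runLaw r n).bind fun h =>
      (iidLaw l (sampleLaw X (centers r h))).map fun c => c :: h

/-- `HIT(K)`: the number of candidates that lie in `K`, counted only in those steps in which `K`
is neither covered nor solved with respect to the centers chosen before the step. -/
def hits {d : ℕ} {X : Finset (Pt d)} {l : ℕ} (r : Rule X l) (K : Finset (Pt d)) :
    History X l → ℕ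
  | [] => 0
  | c :: h => hits r K h +
      if IsCovered K (centers r h) ∨ IsSolved K (centers r h) then 0
      else (Finset.univ.filter fun j : Fin l => (c j : Pt d) ∈ K).card

/-- The expectation of a count under a discrete law, in `[0, ∞]`. -/
def expectation {α : Type*} (p : PMF α) (f : α → ℕ) : ℝ≥0∞ := ∑' a, p a * (f a : ℝ≥0∞)

end

end GreedyKMeans

/-! A potential function charges the expected hits to a decrease of an energy. Let `D` be the
distance from the center of mass of `K` to `C`, let `P = cost X C` and `u = |K| D² / P`. While `K`
is pending, `cost K C` is `|K| D²` up to constants, so a step produces about `l u` hits in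
expectation. If `P ≥ k * cost K C`, this is at most `l / k`, harmless over `k` steps. Otherwise the
energy must drop by order `l u` (`IsPending.iidMean_pendingEnergy_le_of_lt`).

Let `B` be the points very near the center of mass, and `G` the points whose choice lowers the total
cost by order `|B| D²`; then `B ⊆ G`. If `l` samples rarely meet `G`, a candidate in `K ∩ B` is
likely the only one in `G`; greediness then selects it, `K` is covered and the whole energy is
released. If they often meet `G`, the selected point lies in `G`, and the logarithm of the cost
falls by order `|B| D² / P`. Its coefficient `l * S`, with `S` the smoothed share of `K` near its
center of mass, turns this into order `l u`, because `S |B|` is at least of order `|K|`.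

The logarithm is normalized by the scale of `D`, so it may jump up when `D` enters a lower scale.
The term with `2 - S` pays for the jump if `S` grows by a factor `1 + t`, where `t` is of order `1 /
(l * logCap k)`. Points that lower the scale without such growth are rare (`card_shallowPoints_le`),
and their expected damage is a small multiple of `l u`. As the energy is `O((l * logCap k)²)`,
summing the drift gives the bound. -/

namespace GreedyKMeans

noncomputable section

open scoped ENNReal Classical

/-! ### Expectations over independent samples. -/

section ProductLaw

variable {α : Type*} [Fintype α] {l : ℕ}

/-- The mean of `f` over `l` independent samples with weights `w`. -/
def iidMean (w : α → ℝ) (f : (Fin l → α) → ℝ) : ℝ := ∑ c : Fin l → α, (∏ j, w (c j)) * f c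

theorem iidMean_prod (w : α → ℝ) (u : Fin l → α → ℝ) :
    iidMean w (fun c => ∏ j, u j (c j)) = ∏ j, ∑ x, w x * u j x := by
  rw [Finset.prod_univ_sum, Fintype.piFinset_univ]
  simp [iidMean, Finset.prod_mul_distrib]

theorem iidMean_const {w : α → ℝ} (hw : ∑ x, w x = 1) (a : ℝ) :
    iidMean (l := l) w (fun _ => a) = a := by
  have h := iidMean_prod w (fun (_ : Fin l) _ => 1)
  simp only [iidMean, Finset.prod_const_one, mul_one, hw] at h
  simp [iidMean, ← Finset.sum_mul, h]

theorem iidMean_add (w : α → ℝ) (f g : (Fin l → α) → ℝ) :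
    iidMean w (fun c => f c + g c) = iidMean w f + iidMean w g := by
  simp [iidMean, mul_add, Finset.sum_add_distrib]

theorem iidMean_const_mul (w : α → ℝ) (a : ℝ) (f : (Fin l → α) → ℝ) :
    iidMean w (fun c => a * f c) = a * iidMean w f := by
  simp only [iidMean, Finset.mul_sum]
  exact Finset.sum_congr rfl fun c _ => by ring

theorem iidMean_sum {ι : Type*} (s : Finset ι) (w : α → ℝ) (f : ι → (Fin l → α) → ℝ) :
    iidMean w (fun c => ∑ i ∈ s, f i c) = ∑ i ∈ s, iidMean w (f i) := by
  simp only [iidMean, Finset.mul_sum]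
  exact Finset.sum_comm

theorem iidMean_mono {w : α → ℝ} (hw : ∀ x, 0 ≤ w x) {f g : (Fin l → α) → ℝ}
    (h : ∀ c, f c ≤ g c) : iidMean w f ≤ iidMean w g :=
  Finset.sum_le_sum fun c _ =>
    mul_le_mul_of_nonneg_left (h c) (Finset.prod_nonneg fun j _ => hw (c j))

variable [DecidableEq α]

theorem iidMean_apply {w : α → ℝ} (hw : ∑ x, w x = 1) (s : Finset α) (j : Fin l) :
    iidMean w (fun c => if c j ∈ s then 1 else 0) = ∑ x ∈ s, w x := by
  have h := iidMean_prod w (fun (i : Fin l) x => if i = j then (if x ∈ s then 1 else 0) else 1)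
  rw [Finset.prod_eq_single j] at h
  · simp only [Finset.prod_ite_eq', Finset.mem_univ, if_true] at h
    rw [h]
    simp
  · intro i _ hi
    simp [hi, hw]
  · simp

theorem iidMean_count {w : α → ℝ} (hw : ∑ x, w x = 1) (s : Finset α) :
    iidMean w (fun c : Fin l → α => ∑ j, if c j ∈ s then 1 else 0) = l * ∑ x ∈ s, w x := by
  rw [iidMean_sum, Finset.sum_congr rfl fun j _ => iidMean_apply hw s j]
  simp

theorem iidMean_exists_le {w : α → ℝ} (hw0 : ∀ x, 0 ≤ w x) (hw : ∑ x, w x = 1)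
    (s : Finset α) :
    iidMean w (fun c : Fin l → α => if ∃ j, c j ∈ s then 1 else 0) ≤ l * ∑ x ∈ s, w x := by
  rw [← iidMean_count hw s]
  refine iidMean_mono hw0 fun c => ?_
  split_ifs with h
  · obtain ⟨j, hj⟩ := h
    have := Finset.single_le_sum (f := fun j => if c j ∈ s then (1 : ℝ) else 0)
      (fun i _ => by positivity) (Finset.mem_univ j)
    simpa [hj] using this
  · exact Finset.sum_nonneg fun i _ => by positivity

theorem sum_mul_ite_notMem {w : α → ℝ} (hw : ∑ x, w x = 1) (s : Finset α) :
    ∑ x, w x * (if x ∈ s then 0 else 1) = 1 - ∑ x ∈ s, w x := by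
  have h : ∀ x, w x * (if x ∈ s then 0 else 1) = w x - if x ∈ s then w x else 0 := by
    intro x; split_ifs <;> simp
  simp [h, Finset.sum_sub_distrib, hw]

theorem iidMean_exists {w : α → ℝ} (hw : ∑ x, w x = 1) (s : Finset α) :
    iidMean w (fun c : Fin l → α => if ∃ j, c j ∈ s then 1 else 0) =
      1 - (1 - ∑ x ∈ s, w x) ^ l := by
  have h1 := iidMean_prod w (fun (_ : Fin l) x => if x ∈ s then 0 else 1)
  simp only [sum_mul_ite_notMem hw, Finset.prod_const, Finset.card_univ, Fintype.card_fin] at h1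
  have h2 : ∀ c : Fin l → α, (if ∃ j, c j ∈ s then (1 : ℝ) else 0) =
      1 + (-1) * ∏ j, (if c j ∈ s then 0 else 1) := by
    intro c
    split_ifs with h
    · obtain ⟨j, hj⟩ := h
      rw [Finset.prod_eq_zero (Finset.mem_univ j) (by simp [hj])]
      ring
    · push Not at h
      simp [h]
  simp only [h2]
  rw [iidMean_add, iidMean_const hw, iidMean_const_mul, h1]
  ring

/-- For distinct `j` the events "`c j` is in `t` and all other samples avoid `s`" are disjoint,
because `t ⊆ s`; each has a product probability. -/
theorem le_iidMean_unique {w : α → ℝ} (hw0 : ∀ x, 0 ≤ w x) (hw : ∑ x, w x = 1)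
    {s t : Finset α} (hst : t ⊆ s) :
    l * (∑ x ∈ t, w x) * (1 - ∑ x ∈ s, w x) ^ (l - 1) ≤
      iidMean w (fun c : Fin l → α =>
        if ∃ j, c j ∈ t ∧ ∀ i, i ≠ j → c i ∉ s then 1 else 0) := by
  have h1 : ∀ j : Fin l, iidMean w (fun c => ∏ i,
      (if i = j then (if c i ∈ t then 1 else 0) else (if c i ∈ s then 0 else 1))) =
      (∑ x ∈ t, w x) * (1 - ∑ x ∈ s, w x) ^ (l - 1) := by
    intro j
    rw [iidMean_prod w (fun i x =>
      if i = j then (if x ∈ t then 1 else 0) else (if x ∈ s then 0 else 1)),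
      ← Finset.mul_prod_erase Finset.univ _ (Finset.mem_univ j)]
    congr 1
    · simp
    · rw [Finset.prod_congr rfl (g := fun _ => 1 - ∑ x ∈ s, w x)]
      · simp
      · intro i hi
        simp only [Finset.ne_of_mem_erase hi, if_false, sum_mul_ite_notMem hw]
  have h2 : l * (∑ x ∈ t, w x) * (1 - ∑ x ∈ s, w x) ^ (l - 1) =
      ∑ j : Fin l, iidMean w (fun c => ∏ i,
      (if i = j then (if c i ∈ t then 1 else 0) else (if c i ∈ s then 0 else 1))) := by
    simp only [h1]
    simp [mul_assoc]
  rw [h2, ← iidMean_sum]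
  refine iidMean_mono hw0 fun c => ?_
  have h3 : ∀ j, (∏ i, (if i = j then (if c i ∈ t then (1 : ℝ) else 0)
      else (if c i ∈ s then 0 else 1))) ≠ 0 → c j ∈ t ∧ ∀ i, i ≠ j → c i ∉ s := by
    intro j hj
    rw [Finset.prod_ne_zero_iff] at hj
    refine ⟨by simpa using hj j (Finset.mem_univ j), fun i hi => ?_⟩
    simpa [hi] using hj i (Finset.mem_univ i)
  split_ifs with h
  · obtain ⟨j, hj, hj'⟩ := h
    rw [Finset.sum_eq_single j]
    · exact Finset.prod_le_one (fun i _ => by positivity) fun i _ => by split_ifs <;> simp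
    · intro i _ hi
      by_contra hne
      exact (h3 i hne).2 j (Ne.symm hi) (hst hj)
    · simp
  · push Not at h
    refine (Finset.sum_eq_zero fun j _ => ?_).le
    by_contra hne
    obtain ⟨i, hi, hi'⟩ := h j (h3 j hne).1
    exact (h3 j hne).2 i hi hi'

end ProductLaw

/-! ### Geometric smoothing of a monotone sequence. -/

section GeometricAverage

/-- The average of `a j, a (j - 1), a (j - 2), …` with weights `1/2, 1/4, 1/8, …`. -/
def geomAverage (a : ℤ → ℝ) (j : ℤ) : ℝ := ∑' i : ℕ, (1 / 2 : ℝ) ^ (i + 1) * a (j - i)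

variable {a : ℤ → ℝ}

theorem hasSum_half_pow_succ : HasSum (fun i : ℕ => (1 / 2 : ℝ) ^ (i + 1)) 1 := by
  have h := hasSum_geometric_two.mul_left (1 / 2 : ℝ)
  norm_num at h
  simpa [pow_succ, mul_comm] using h

theorem summable_geomAverage (h0 : ∀ j, 0 ≤ a j) (h1 : ∀ j, a j ≤ 1) (j : ℤ) :
    Summable fun i : ℕ => (1 / 2 : ℝ) ^ (i + 1) * a (j - i) :=
  Summable.of_nonneg_of_le (fun i => mul_nonneg (by positivity) (h0 _))
    (fun i => mul_le_of_le_one_right (by positivity) (h1 _)) hasSum_half_pow_succ.summable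

theorem geomAverage_le_one (h0 : ∀ j, 0 ≤ a j) (h1 : ∀ j, a j ≤ 1) (j : ℤ) :
    geomAverage a j ≤ 1 := by
  rw [← hasSum_half_pow_succ.tsum_eq]
  exact (summable_geomAverage h0 h1 j).tsum_le_tsum
    (fun i => mul_le_of_le_one_right (by positivity) (h1 _)) hasSum_half_pow_succ.summable

/-- This identity is the reason for the weights `1/2, 1/4, …`: if the average barely grows from `j`
to `j - 1`, then `a j` is already close to the average at `j`. -/
theorem geomAverage_sub_one (h0 : ∀ j, 0 ≤ a j) (h1 : ∀ j, a j ≤ 1) (j : ℤ) :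
    geomAverage a (j - 1) = 2 * geomAverage a j - a j := by
  have h := (summable_geomAverage h0 h1 j).tsum_eq_zero_add
  have h2 : ∀ i : ℕ, (1 / 2 : ℝ) ^ (i + 1 + 1) * a (j - (i + 1 : ℕ)) =
      1 / 2 * ((1 / 2) ^ (i + 1) * a (j - 1 - i)) := by
    intro i
    rw [show j - ((i + 1 : ℕ) : ℤ) = j - 1 - i by push_cast; ring]
    ring
  simp only [h2, tsum_mul_left] at h
  simp only [geomAverage]
  rw [h]
  norm_num
  ring

theorem geomAverage_antitone (h0 : ∀ j, 0 ≤ a j) (h1 : ∀ j, a j ≤ 1) (ha : Antitone a) :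
    Antitone (geomAverage a) := fun i j hij =>
  (summable_geomAverage h0 h1 j).tsum_le_tsum
    (fun m => mul_le_mul_of_nonneg_left (ha (by omega)) (by positivity))
    (summable_geomAverage h0 h1 i)

theorem le_geomAverage (h0 : ∀ j, 0 ≤ a j) (h1 : ∀ j, a j ≤ 1) (ha : Antitone a) (j : ℤ) :
    a j ≤ geomAverage a j := by
  have h := geomAverage_antitone h0 h1 ha (show j - 1 ≤ j by omega)
  rw [geomAverage_sub_one h0 h1] at h
  linarith

theorem quarter_le_geomAverage (h0 : ∀ j, 0 ≤ a j) (h1 : ∀ j, a j ≤ 1) (ha : Antitone a)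
    (j : ℤ) : a (j - 1) / 4 ≤ geomAverage a j := by
  have h := le_geomAverage h0 h1 ha (j - 1)
  rw [geomAverage_sub_one h0 h1] at h
  linarith [h0 j, le_geomAverage h0 h1 ha j, h0 (j - 1)]

end GeometricAverage

/-! ### Geometry of a pending cluster. -/

section Geometry

variable {d : ℕ} {X K C C' : Finset (Pt d)} {x y z : Pt d}

theorem pointCost_anti (h : C ⊆ C') (hC : C.Nonempty) (x : Pt d) :
    pointCost x C' ≤ pointCost x C :=
  pow_le_pow_left₀ Metric.infDist_nonneg
    (Metric.infDist_le_infDist_of_subset (by exact_mod_cast h) (by exact_mod_cast hC)) 2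

theorem cost_anti (K : Finset (Pt d)) (h : C ⊆ C') (hC : C.Nonempty) :
    cost K C' ≤ cost K C := Finset.sum_le_sum fun x _ => pointCost_anti h hC x

theorem cost_mono_left (h : K ⊆ X) (C : Finset (Pt d)) : cost K C ≤ cost X C :=
  Finset.sum_le_sum_of_subset_of_nonneg h fun x _ _ => pointCost_nonneg x C

theorem pointCost_le_of_mem (h : y ∈ C) (x : Pt d) : pointCost x C ≤ dist x y ^ 2 :=
  pow_le_pow_left₀ Metric.infDist_nonneg (Metric.infDist_le_dist_of_mem (by exact_mod_cast h)) 2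

theorem infDist_insert_eq_of_lt
    (h : Metric.infDist z (insert x C : Finset (Pt d)) < Metric.infDist z C) :
    Metric.infDist z (insert x C : Finset (Pt d)) = dist x z := by
  obtain ⟨y, hy, hxy⟩ := (insert x C).finite_toSet.isCompact.exists_infDist_eq_dist
    (by simp) z
  rw [hxy] at h ⊢
  rw [Finset.mem_coe, Finset.mem_insert] at hy
  rcases hy with rfl | hy
  · exact dist_comm _ _
  · exact absurd h (not_lt.2 (Metric.infDist_le_dist_of_mem (by exact_mod_cast hy)))

theorem optCost_eq (K : Finset (Pt d)) : optCost K = ∑ x ∈ K, dist x (centroid K) ^ 2 := by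
  simp [optCost, cost, pointCost]

/-- With `infDist_le_cost`, this shows that for an unsolved cluster, where `optCost K` is
negligible, `cost K C` and `|K| D²` agree up to a constant. Both use the triangle inequality through
the center of mass and `(a + b)² ≤ 2a² + 2b²`. -/
theorem cost_le_infDist (K C : Finset (Pt d)) :
    cost K C ≤ 2 * (K.card * Metric.infDist (centroid K) C ^ 2) + 2 * optCost K := by
  have h : ∀ x ∈ K, pointCost x C ≤
      2 * Metric.infDist (centroid K) C ^ 2 + 2 * dist x (centroid K) ^ 2 := by
    intro x _
    have h1 : Metric.infDist x (C : Set (Pt d)) ≤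
        Metric.infDist (centroid K) C + dist x (centroid K) :=
      Metric.infDist_le_infDist_add_dist
    have h2 : 0 ≤ Metric.infDist x (C : Set (Pt d)) := Metric.infDist_nonneg
    unfold pointCost
    nlinarith [sq_nonneg (Metric.infDist (centroid K) C - dist x (centroid K))]
  refine (Finset.sum_le_sum h).trans_eq ?_
  rw [Finset.sum_add_distrib, ← Finset.mul_sum, ← Finset.mul_sum, ← optCost_eq]
  simp

theorem infDist_le_cost (K C : Finset (Pt d)) :
    K.card * Metric.infDist (centroid K) C ^ 2 ≤ 2 * cost K C + 2 * optCost K := by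
  have h : ∀ x ∈ K, Metric.infDist (centroid K) C ^ 2 ≤
      2 * pointCost x C + 2 * dist x (centroid K) ^ 2 := by
    intro x _
    have h1 : Metric.infDist (centroid K) C ≤
        Metric.infDist x (C : Set (Pt d)) + dist x (centroid K) := by
      rw [dist_comm]
      exact Metric.infDist_le_infDist_add_dist
    have h2 : 0 ≤ Metric.infDist (centroid K) (C : Set (Pt d)) := Metric.infDist_nonneg
    unfold pointCost
    nlinarith [sq_nonneg (Metric.infDist x C - dist x (centroid K))]
  have h2 := Finset.sum_le_sum h
  rw [Finset.sum_add_distrib, ← Finset.mul_sum, ← Finset.mul_sum, ← optCost_eq] at h2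
  simpa [cost] using h2

theorem optCost_nonneg (K : Finset (Pt d)) : 0 ≤ optCost K := cost_nonneg _ _

/-- `K` is neither covered nor solved with respect to the nonempty set `C`. -/
structure IsPending (K C : Finset (Pt d)) : Prop where
  nonempty : C.Nonempty
  not_covered : ¬ IsCovered K C
  cost_lt : 10 ^ 5 * optCost K < cost K C

theorem isPending_iff (hC : C.Nonempty) :
    IsPending K C ↔ ¬ (IsCovered K C ∨ IsSolved K C) := by
  constructor
  · rintro ⟨_, h1, h2⟩ (h | h)
    · exact h1 h
    · exact absurd h.2 (not_le.2 h2)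
  · intro h
    push Not at h
    exact ⟨hC, h.1, not_le.1 fun h' => h.2 ⟨hC, h'⟩⟩

/-- Read contrapositively: a cluster that has stopped being pending never becomes pending again, so
the energy stays zero. -/
theorem IsPending.of_insert (hC : C.Nonempty) (h : IsPending K (insert x C)) :
    IsPending K C where
  nonempty := hC
  not_covered h' := h.not_covered
    (h'.mono (Finset.inter_subset_inter_left (Finset.subset_insert x C)))
  cost_lt := h.cost_lt.trans_le (cost_anti K (Finset.subset_insert x C) hC)

theorem IsPending.notMem (h : IsPending K (insert x C)) : x ∉ K := fun hx =>
  h.not_covered ⟨x, by simp [hx]⟩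

namespace IsPending

theorem cost_pos (h : IsPending K C) : 0 < cost K C := by
  have h1 := h.cost_lt
  have h2 := optCost_nonneg K
  linarith

theorem card_pos (h : IsPending K C) : (0 : ℝ) < K.card := by
  have h1 : K.Nonempty := by
    by_contra hK
    rw [Finset.not_nonempty_iff_eq_empty] at hK
    have := h.cost_pos
    simp [cost, hK] at this
  exact_mod_cast h1.card_pos

theorem cost_le (h : IsPending K C) : cost K C ≤ 21 / 10 * (K.card * Metric.infDist (centroid K) C ^ 2) := by
  have h1 := h.cost_lt
  have h2 := cost_le_infDist K C
  have h3 := optCost_nonneg K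
  linarith

theorem le_cost (h : IsPending K C) : K.card * Metric.infDist (centroid K) C ^ 2 ≤ 21 / 10 * cost K C := by
  have h1 := h.cost_lt
  have h2 := infDist_le_cost K C
  have h3 := optCost_nonneg K
  linarith

theorem infDist_pos (h : IsPending K C) : 0 < Metric.infDist (centroid K) (C : Set (Pt d)) := by
  refine lt_of_le_of_ne Metric.infDist_nonneg fun h0 => ?_
  have h1 := h.cost_le
  have h2 := h.cost_pos
  rw [← h0] at h1
  simp at h1
  linarith

end IsPending

/-- The index `j` with `4 ^ j ≤ dist (μ(K), C) < 4 ^ (j + 1)`. -/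
def scale (K C : Finset (Pt d)) : ℤ := Int.log 4 (Metric.infDist (centroid K) (C : Set (Pt d)))

/-- The points of `X` at distance less than `4 ^ j` from the center of mass of `K`. -/
def nearPoints (X K : Finset (Pt d)) (j : ℤ) : Finset (Pt d) :=
  X.filter fun x => dist x (centroid K) < (4 : ℝ) ^ j

theorem IsPending.zpow_scale_le (h : IsPending K C) :
    (4 : ℝ) ^ scale K C ≤ Metric.infDist (centroid K) (C : Set (Pt d)) := by
  have := Int.zpow_log_le_self (b := 4) (by norm_num) h.infDist_pos
  exact_mod_cast this

theorem lt_zpow_scale (K C : Finset (Pt d)) :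
    Metric.infDist (centroid K) (C : Set (Pt d)) < 4 * (4 : ℝ) ^ scale K C := by
  have := Int.lt_zpow_succ_log_self (b := 4) (by norm_num)
    (Metric.infDist (centroid K) (C : Set (Pt d)))
  rw [zpow_add_one₀ (by norm_num)] at this
  push_cast at this
  rw [mul_comm]
  exact this

theorem zpow_sub_one_eq (j : ℤ) : (4 : ℝ) ^ (j - 1) = 4 ^ j / 4 := by
  rw [zpow_sub_one₀ (by norm_num)]
  ring

/-- Markov's inequality: each point of `K` outside the ball contributes at least `(4 ^ j / 4)²` to
`optCost K`, which is below `10⁻⁵ * cost K C`, hence a tiny multiple of `|K| (4 ^ j)²`. -/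
theorem IsPending.card_sdiff_near (h : IsPending K C) (hK : K ⊆ X) :
    ((K \ nearPoints X K (scale K C - 1)).card : ℝ) ≤ K.card / 100 := by
  set j := scale K C
  have hr : (0 : ℝ) < 4 ^ j := by positivity
  have h1 : ((K \ nearPoints X K (j - 1)).card : ℝ) * ((4 : ℝ) ^ j / 4) ^ 2 ≤ optCost K := by
    rw [optCost_eq, ← nsmul_eq_mul]
    refine (Finset.card_nsmul_le_sum _ (fun x => dist x (centroid K) ^ 2) _ fun x hx => ?_).trans
      (Finset.sum_le_sum_of_subset_of_nonneg Finset.sdiff_subset fun _ _ _ => sq_nonneg _)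
    rw [Finset.mem_sdiff, nearPoints, Finset.mem_filter, zpow_sub_one_eq] at hx
    exact pow_le_pow_left₀ (by positivity) (not_lt.1 fun h' => hx.2 ⟨hK hx.1, h'⟩) 2
  have h2 := h.cost_lt
  have h3 := h.cost_le
  have h4 := lt_zpow_scale K C
  have h5 : Metric.infDist (centroid K) (C : Set (Pt d)) ^ 2 ≤ (4 * (4 : ℝ) ^ j) ^ 2 :=
    pow_le_pow_left₀ Metric.infDist_nonneg h4.le 2
  have h6 := mul_le_mul_of_nonneg_left h5 h.card_pos.le
  have h7 : 0 < ((4 : ℝ) ^ j) ^ 2 := by positivity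
  generalize (4 : ℝ) ^ j = r at *
  by_contra h8
  push Not at h8
  have h9 := mul_lt_mul_of_pos_right h8 h7
  nlinarith

theorem IsPending.card_inter_near (h : IsPending K C) (hK : K ⊆ X) :
    99 / 100 * (K.card : ℝ) ≤ (K ∩ nearPoints X K (scale K C - 1)).card := by
  have h1 := h.card_sdiff_near hK
  have h2 := Finset.card_inter_add_card_sdiff K (nearPoints X K (scale K C - 1))
  have h3 : ((K ∩ nearPoints X K (scale K C - 1)).card : ℝ) +
    ((K \ nearPoints X K (scale K C - 1)).card : ℝ) = K.card := by exact_mod_cast h2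
  linarith

theorem IsPending.card_union_near (h : IsPending K C) (hK : K ⊆ X) :
    ((K ∪ nearPoints X K (scale K C - 1)).card : ℝ) ≤
      2 * (nearPoints X K (scale K C - 1)).card := by
  have h1 := h.card_sdiff_near hK
  have h2 := h.card_inter_near hK
  have h3 := h.card_pos
  have h4 : ((K ∩ nearPoints X K (scale K C - 1)).card : ℝ) ≤
      (nearPoints X K (scale K C - 1)).card := by
    exact_mod_cast Finset.card_le_card Finset.inter_subset_right
  have h5 : ((K ∪ nearPoints X K (scale K C - 1)).card : ℝ) +
      (K ∩ nearPoints X K (scale K C - 1)).card =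
      K.card + (nearPoints X K (scale K C - 1)).card := by
    exact_mod_cast Finset.card_union_add_card_inter _ _
  linarith

theorem IsPending.dist_near_le (h : IsPending K C)
    (hx : x ∈ nearPoints X K (scale K C - 1)) :
    dist x (centroid K) ≤ Metric.infDist (centroid K) (C : Set (Pt d)) / 4 := by
  rw [nearPoints, Finset.mem_filter, zpow_sub_one_eq] at hx
  linarith [h.zpow_scale_le, hx.2]

theorem IsPending.pointCost_near_ge (h : IsPending K C)
    (hx : x ∈ nearPoints X K (scale K C - 1)) :
    9 / 16 * Metric.infDist (centroid K) (C : Set (Pt d)) ^ 2 ≤ pointCost x C := by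
  have h1 := h.dist_near_le hx
  have h2 : Metric.infDist (centroid K) C ≤
      Metric.infDist x (C : Set (Pt d)) + dist x (centroid K) := by
    rw [dist_comm]
    exact Metric.infDist_le_infDist_add_dist
  have h3 := h.infDist_pos
  have h4 : 3 / 4 * Metric.infDist (centroid K) (C : Set (Pt d)) ≤ Metric.infDist x C := by
    linarith
  have h5 := pow_le_pow_left₀ (by positivity) h4 2
  unfold pointCost
  linarith

/-- Every near point costs at least `(3D/4)²` before and at most `(D/2)²` after the insertion, and
`9/16 - 1/4 = 5/16`. -/
theorem IsPending.cost_insert_near_le (h : IsPending K C)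
    (hx : x ∈ nearPoints X K (scale K C - 1)) :
    cost X (insert x C) ≤ cost X C - 5 / 16 * ((nearPoints X K (scale K C - 1)).card *
      Metric.infDist (centroid K) (C : Set (Pt d)) ^ 2) := by
  set B := nearPoints X K (scale K C - 1)
  set D := Metric.infDist (centroid K) (C : Set (Pt d))
  have h1 : ∀ z ∈ X, pointCost z (insert x C) ≤
      pointCost z C - if z ∈ B then 5 / 16 * D ^ 2 else 0 := by
    intro z _
    split_ifs with hz
    · have h2 := h.pointCost_near_ge hz
      have h3 : dist z x ≤ D / 2 := by
        have := dist_triangle_right z x (centroid K)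
        linarith [h.dist_near_le hx, h.dist_near_le hz]
      have h4 := pow_le_pow_left₀ dist_nonneg h3 2
      have h5 := pointCost_le_of_mem (Finset.mem_insert_self x C) z
      linarith
    · simpa using pointCost_anti (Finset.subset_insert x C) h.nonempty z
  refine (Finset.sum_le_sum h1).trans_eq ?_
  rw [Finset.sum_sub_distrib, Finset.sum_ite_mem,
    Finset.inter_eq_right.2 (show B ⊆ X from Finset.filter_subset _ _)]
  simp [cost]
  ring

end Geometry

/-! ### The energy and its change in one step. -/

section Energy

variable {d k l : ℕ} {X K C C' : Finset (Pt d)} {x : Pt d}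

theorem nearPoints_mono (X K : Finset (Pt d)) : Monotone (nearPoints X K) := fun i j hij x hx => by
  rw [nearPoints, Finset.mem_filter] at hx ⊢
  exact ⟨hx.1, hx.2.trans_le (zpow_le_zpow_right₀ (by norm_num) hij)⟩

/-- The share of `K` among the points of `K` and the points at distance less than `4 ^ j`. -/
def share (X K : Finset (Pt d)) (j : ℤ) : ℝ := K.card / (K ∪ nearPoints X K j).card

theorem share_nonneg (X K : Finset (Pt d)) (j : ℤ) : 0 ≤ share X K j := by
  unfold share; positivity

theorem share_le_one (X K : Finset (Pt d)) (j : ℤ) : share X K j ≤ 1 :=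
  div_le_one_of_le₀ (by exact_mod_cast Finset.card_le_card Finset.subset_union_left)
    (by positivity)

theorem card_union_pos (hK : (0 : ℝ) < K.card) (j : ℤ) :
    (0 : ℝ) < (K ∪ nearPoints X K j).card :=
  hK.trans_le (by exact_mod_cast Finset.card_le_card Finset.subset_union_left)

theorem share_antitone (X K : Finset (Pt d)) : Antitone (share X K) := fun i j hij => by
  rcases K.eq_empty_or_nonempty with rfl | hK
  · simp [share]
  · have h : (0 : ℝ) < K.card := by exact_mod_cast hK.card_pos
    exact div_le_div_of_nonneg_left h.le (card_union_pos h i)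
      (Nat.cast_le.2 (Finset.card_le_card
        (Finset.union_subset_union_right (nearPoints_mono X K hij))))

/-- A smoothed version of `share`. -/
def smoothShare (X K : Finset (Pt d)) (j : ℤ) : ℝ := geomAverage (share X K) j

theorem smoothShare_le_one (X K : Finset (Pt d)) (j : ℤ) : smoothShare X K j ≤ 1 :=
  geomAverage_le_one (share_nonneg X K) (share_le_one X K) j

theorem smoothShare_antitone (X K : Finset (Pt d)) : Antitone (smoothShare X K) :=
  geomAverage_antitone (share_nonneg X K) (share_le_one X K) (share_antitone X K)

theorem share_le_smoothShare (X K : Finset (Pt d)) (j : ℤ) : share X K j ≤ smoothShare X K j :=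
  le_geomAverage (share_nonneg X K) (share_le_one X K) (share_antitone X K) j

theorem smoothShare_pos (hK : (0 : ℝ) < K.card) (j : ℤ) : 0 < smoothShare X K j :=
  (div_pos hK (card_union_pos hK j)).trans_le (share_le_smoothShare X K j)

theorem smoothShare_nonneg (X K : Finset (Pt d)) (j : ℤ) : 0 ≤ smoothShare X K j :=
  (share_nonneg X K j).trans (share_le_smoothShare X K j)

/-- The points outside `K` that decrease the scale `j` while `smoothShare` grows by a factor
of less than `1 + t`. -/
def shallowPoints (X K : Finset (Pt d)) (j : ℤ) (t : ℝ) : Finset (Pt d) :=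
  X.filter fun x => x ∉ K ∧ 0 < dist x (centroid K) ∧ dist x (centroid K) < (4 : ℝ) ^ j ∧
    smoothShare X K (Int.log 4 (dist x (centroid K))) < (1 + t) * smoothShare X K j

/-- Let `i` be the scale of the nearest shallow point. Slow growth of the average pins both `|K ∪
nearPoints X K j|` and `|K ∪ nearPoints X K i|` to about `|K| / S`, up to factors `1 ± t`. All
shallow points lie in the difference of these two sets. -/
theorem card_shallowPoints_le (hK : (0 : ℝ) < K.card) (j : ℤ) {t : ℝ} (ht0 : 0 ≤ t)
    (ht : t ≤ 1 / 2) :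
    smoothShare X K j * (shallowPoints X K j t).card ≤ 3 * t * K.card := by
  rcases (shallowPoints X K j t).eq_empty_or_nonempty with h | h
  · rw [h]
    simp only [Finset.card_empty, Nat.cast_zero, mul_zero]
    positivity
  obtain ⟨x, hx, hmin⟩ := Finset.exists_min_image _ (fun x => dist x (centroid K)) h
  have hx' := hx
  simp only [shallowPoints, Finset.mem_filter] at hx'
  obtain ⟨hxX, hxK, hx0, hxj, hxS⟩ := hx'
  set i := Int.log 4 (dist x (centroid K)) with hi
  have h4i : (4 : ℝ) ^ i ≤ dist x (centroid K) := by
    have := Int.zpow_log_le_self (b := 4) (by norm_num) hx0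
    exact_mod_cast this
  have hij : i < j := by
    by_contra hji
    push Not at hji
    have : (4 : ℝ) ^ j ≤ 4 ^ i := zpow_le_zpow_right₀ (by norm_num) hji
    linarith
  have hS := smoothShare_pos (X := X) hK j
  have h1 : smoothShare X K (j - 1) = 2 * smoothShare X K j - share X K j :=
    geomAverage_sub_one (share_nonneg X K) (share_le_one X K) j
  have h2 : smoothShare X K (j - 1) ≤ smoothShare X K i :=
    smoothShare_antitone X K (by omega)
  have h3 := share_le_smoothShare X K i
  have hNi := card_union_pos (X := X) hK i
  have hNj := card_union_pos (X := X) hK j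
  -- As `i ≤ j - 1`, the average at `j - 1` is below `(1 + t) * S`, so the recursion `h1` gives a
  -- share at `j` of at least `(1 - t) * S`.
  have h4 : (1 - t) * smoothShare X K j * (K ∪ nearPoints X K j).card ≤ K.card := by
    rw [← le_div_iff₀ hNj]
    change _ ≤ share X K j
    linarith
  have h5 : (K.card : ℝ) ≤ (1 + t) * smoothShare X K j * (K ∪ nearPoints X K i).card := by
    rw [← div_le_iff₀ hNi]
    change share X K i ≤ _
    linarith
  have h6 : ((shallowPoints X K j t).card : ℝ) + (K ∪ nearPoints X K i).card ≤
      (K ∪ nearPoints X K j).card := by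
    rw [← Nat.cast_add, ← Finset.card_union_of_disjoint]
    · refine Nat.cast_le.2 (Finset.card_le_card (Finset.union_subset (fun y hy => ?_)
        (Finset.union_subset_union_right (nearPoints_mono X K hij.le))))
      simp only [shallowPoints, Finset.mem_filter] at hy
      simp [nearPoints, hy.1, hy.2.2.2.1]
    · rw [Finset.disjoint_left]
      intro y hy hy2
      have h7 := hmin y hy
      simp only [shallowPoints, Finset.mem_filter] at hy
      simp only [nearPoints, Finset.mem_union, Finset.mem_filter] at hy2
      rcases hy2 with hy2 | hy2
      · exact hy.2.1 hy2
      · linarith [hy2.2]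
  have hf : (0 : ℝ) ≤ (shallowPoints X K j t).card := by positivity
  generalize ((shallowPoints X K j t).card : ℝ) = f at *
  generalize ((K ∪ nearPoints X K i).card : ℝ) = a at *
  generalize ((K ∪ nearPoints X K j).card : ℝ) = b at *
  generalize smoothShare X K j = S at *
  generalize (K.card : ℝ) = n at *
  have h7 : S * f ≤ S * b - S * a := by nlinarith
  have h8 : (1 - t) * (1 + t) * (S * b - S * a) ≤ 2 * t * n := by nlinarith
  have h9 : 2 / 3 ≤ (1 - t) * (1 + t) := by nlinarith
  have h10 : 0 ≤ S * b - S * a := (mul_nonneg hS.le hf).trans h7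
  nlinarith

/-- An upper bound for the logarithmic part of the energy. -/
def logCap (k : ℕ) : ℝ := Real.log (1 + 1000 * k)

theorem one_le_logCap (hk : 2 ≤ k) : 1 ≤ logCap k := by
  have hk' : (2 : ℝ) ≤ k := by exact_mod_cast hk
  rw [logCap, Real.le_log_iff_exp_le (by positivity)]
  have := Real.exp_one_lt_d9
  linarith

theorem logCap_le (hk : 2 ≤ k) : logCap k ≤ 11 * Real.log k := by
  have hk' : (2 : ℝ) ≤ k := by exact_mod_cast hk
  have h : (11 : ℝ) * Real.log k = Real.log ((k : ℝ) ^ 11) := by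
    rw [Real.log_pow]; norm_num
  rw [h]
  refine Real.log_le_log (by positivity) ?_
  have h1 : (2 : ℝ) ^ 10 ≤ (k : ℝ) ^ 10 := pow_le_pow_left₀ (by norm_num) hk' 10
  have h2 : (k : ℝ) ^ 11 = (k : ℝ) ^ 10 * k := pow_succ _ _
  nlinarith

/-- The logarithm of the total cost in units of the cost of `K`, truncated. -/
def logRatio (k : ℕ) (X K C : Finset (Pt d)) : ℝ :=
  Real.log (1 + min (cost X C / (K.card * ((4 : ℝ) ^ scale K C) ^ 2)) (1000 * k))

theorem ratio_nonneg (X K C : Finset (Pt d)) :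
    0 ≤ cost X C / (K.card * ((4 : ℝ) ^ scale K C) ^ 2) :=
  div_nonneg (cost_nonneg _ _) (by positivity)

theorem logRatio_nonneg (k : ℕ) (X K C : Finset (Pt d)) : 0 ≤ logRatio k X K C := by
  refine Real.log_nonneg ?_
  have := le_min (ratio_nonneg X K C) (show (0 : ℝ) ≤ 1000 * k by positivity)
  linarith

theorem logRatio_le (k : ℕ) (X K C : Finset (Pt d)) : logRatio k X K C ≤ logCap k := by
  have := le_min (ratio_nonneg X K C) (show (0 : ℝ) ≤ 1000 * k by positivity)
  refine Real.log_le_log (by linarith) ?_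
  linarith [min_le_right (cost X C / (K.card * ((4 : ℝ) ^ scale K C) ^ 2)) (1000 * k)]

/-- The energy of a set of centers for which `K` is pending. -/
def energy (k l : ℕ) (X K C : Finset (Pt d)) : ℝ :=
  300000 * (l * logCap k) ^ 2 * (2 - smoothShare X K (scale K C)) +
    l * smoothShare X K (scale K C) * logRatio k X K C

/-- The energy while `K` is pending, and zero afterwards. -/
def pendingEnergy (k l : ℕ) (X K C : Finset (Pt d)) : ℝ :=
  if IsPending K C then energy k l X K C else 0

theorem one_le_mul_logCap (hk : 2 ≤ k) (hl : 1 ≤ l) : 1 ≤ l * logCap k := by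
  have hl' : (1 : ℝ) ≤ l := by exact_mod_cast hl
  exact one_le_mul_of_one_le_of_one_le hl' (one_le_logCap hk)

/-- The `2` in `2 - S` serves this bound: since `S ≤ 1`, a large amount of energy is released
whenever `K` ceases to be pending. -/
theorem le_energy (k l : ℕ) (X K C : Finset (Pt d)) :
    300000 * (l * logCap k) ^ 2 ≤ energy k l X K C := by
  have h1 := smoothShare_le_one X K (scale K C)
  have h2 : 0 ≤ l * smoothShare X K (scale K C) * logRatio k X K C :=
    mul_nonneg (mul_nonneg (by positivity) (smoothShare_nonneg _ _ _)) (logRatio_nonneg _ _ _ _)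
  have h3 : 0 ≤ 300000 * (l * logCap k) ^ 2 := by positivity
  unfold energy
  nlinarith

theorem energy_le (hk : 2 ≤ k) (hl : 1 ≤ l) (X K C : Finset (Pt d)) :
    energy k l X K C ≤ 600001 * (l * logCap k) ^ 2 := by
  have h0 := smoothShare_nonneg X K (scale K C)
  have h1 := smoothShare_le_one X K (scale K C)
  have hH := one_le_mul_logCap hk hl
  have h2 : l * smoothShare X K (scale K C) * logRatio k X K C ≤ l * 1 * logCap k :=
    mul_le_mul (mul_le_mul_of_nonneg_left h1 (by positivity)) (logRatio_le _ _ _ _)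
      (logRatio_nonneg _ _ _ _) (by positivity)
  have h3 : 0 ≤ 300000 * (l * logCap k) ^ 2 := by positivity
  unfold energy
  nlinarith

/-- The new logarithm is bounded by its cap and the old one by zero. The part of the rise
proportional to the growth of `S` is absorbed by one of the 300000 units of `(l * logCap k)²`. -/
theorem energy_crossing_le (hk : 2 ≤ k) (hl : 1 ≤ l)
    (h : smoothShare X K (scale K C) ≤ smoothShare X K (scale K C')) :
    energy k l X K C' ≤ energy k l X K C + l * logCap k * smoothShare X K (scale K C) -
      299999 * (l * logCap k) ^ 2 *
        (smoothShare X K (scale K C') - smoothShare X K (scale K C)) := by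
  have h0 := smoothShare_nonneg X K (scale K C)
  have hH := one_le_mul_logCap hk hl
  have h2 : l * smoothShare X K (scale K C') * logRatio k X K C' ≤
      l * smoothShare X K (scale K C') * logCap k :=
    mul_le_mul_of_nonneg_left (logRatio_le _ _ _ _)
      (mul_nonneg (by positivity) (smoothShare_nonneg _ _ _))
  have h3 : 0 ≤ l * smoothShare X K (scale K C) * logRatio k X K C :=
    mul_nonneg (mul_nonneg (by positivity) h0) (logRatio_nonneg _ _ _ _)
  have h4 : 0 ≤ ((l * logCap k) ^ 2 - l * logCap k) *
      (smoothShare X K (scale K C') - smoothShare X K (scale K C)) :=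
    mul_nonneg (by nlinarith) (by linarith)
  unfold energy
  nlinarith

theorem energy_le_of_cost_le (h : scale K C' = scale K C) (hc : cost X C' ≤ cost X C) :
    energy k l X K C' ≤ energy k l X K C := by
  have h1 : logRatio k X K C' ≤ logRatio k X K C := by
    have := le_min (ratio_nonneg X K C') (show (0 : ℝ) ≤ 1000 * k by positivity)
    refine Real.log_le_log (by linarith) ?_
    rw [h]
    gcongr
  unfold energy
  rw [h]
  have := mul_le_mul_of_nonneg_left h1
    (mul_nonneg (Nat.cast_nonneg l) (smoothShare_nonneg X K (scale K C)))
  linarith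

theorem log_sub_log_ge {y y' : ℝ} (hy' : 0 ≤ y') (hy : 0 ≤ y) :
    (y - y') / (1 + y) ≤ Real.log (1 + y) - Real.log (1 + y') := by
  have h1 : 0 < 1 + y := by linarith
  have h2 : 0 < 1 + y' := by linarith
  have h := Real.log_le_sub_one_of_pos (div_pos h2 h1)
  rw [Real.log_div h2.ne' h1.ne'] at h
  have : (1 + y') / (1 + y) - 1 = -((y - y') / (1 + y)) := by
    field_simp; ring
  linarith

/-- At a fixed scale only the logarithm changes; `log_sub_log_ge` bounds its drop below by `δ / (Q +
P)`, and `Q ≤ 3P`. -/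
theorem IsPending.energy_drop (h : IsPending K C) (hK : K ⊆ X) (hs : scale K C' = scale K C)
    (hp : cost X C < k * cost K C) {δ : ℝ} (hδ : 0 ≤ δ) (hc : cost X C' ≤ cost X C - δ) :
    energy k l X K C' ≤
      energy k l X K C - l * smoothShare X K (scale K C) * (δ / (4 * cost X C)) := by
  set Q : ℝ := K.card * ((4 : ℝ) ^ scale K C) ^ 2 with hQ
  have hQ0 : 0 < Q := mul_pos h.card_pos (by positivity)
  have hP0 : 0 < cost X C := h.cost_pos.trans_le (cost_mono_left hK C)
  have hQP : Q ≤ 3 * cost X C := by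
    have h1 := h.le_cost
    have h2 : Q ≤ K.card * Metric.infDist (centroid K) (C : Set (Pt d)) ^ 2 :=
      mul_le_mul_of_nonneg_left (pow_le_pow_left₀ (by positivity) h.zpow_scale_le 2)
        (by positivity)
    linarith [cost_mono_left hK C]
  -- The assumption `hp` makes the truncation in `logRatio` inactive: `P < k * cost K C ≤ 40 * k *
  -- Q`.
  have hcap : cost X C / Q ≤ 1000 * k := by
    rw [div_le_iff₀ hQ0]
    have h1 := h.cost_le
    have h2 : Metric.infDist (centroid K) (C : Set (Pt d)) ^ 2 ≤
      (4 * (4 : ℝ) ^ scale K C) ^ 2 :=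
      pow_le_pow_left₀ Metric.infDist_nonneg (lt_zpow_scale K C).le 2
    have h3 := mul_le_mul_of_nonneg_left h2 h.card_pos.le
    have h4 : cost K C ≤ 40 * Q := by rw [hQ]; linarith
    have h5 := mul_le_mul_of_nonneg_left h4 (Nat.cast_nonneg (α := ℝ) k)
    have h6 : 0 ≤ k * Q := by positivity
    linarith
  have hy' : 0 ≤ cost X C' / Q := div_nonneg (cost_nonneg _ _) hQ0.le
  have hy : 0 ≤ cost X C / Q := div_nonneg (cost_nonneg _ _) hQ0.le
  have hle : cost X C' / Q ≤ cost X C / Q := by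
    gcongr
    linarith
  have h1 : logRatio k X K C' ≤ logRatio k X K C - δ / (4 * cost X C) := by
    unfold logRatio
    rw [hs, ← hQ, min_eq_left hcap, min_eq_left (hle.trans hcap)]
    have h2 := log_sub_log_ge hy' hy
    have h3 : δ / (4 * cost X C) ≤ (cost X C / Q - cost X C' / Q) / (1 + cost X C / Q) := by
      have h4 : (cost X C / Q - cost X C' / Q) / (1 + cost X C / Q) =
          (cost X C - cost X C') / (Q + cost X C) := by
        field_simp
      rw [h4]
      exact div_le_div₀ (by linarith) (by linarith) (by linarith) (by linarith)
    linarith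
  have h5 := mul_le_mul_of_nonneg_left h1
    (mul_nonneg (Nat.cast_nonneg l) (smoothShare_nonneg X K (scale K C)))
  unfold energy
  rw [hs]
  linarith

/-- The change of the energy in one step, if it drops by at least `g` when the scale does not
change. -/
theorem IsPending.pendingEnergy_insert_le (h : IsPending K C) (hk : 2 ≤ k) (hl : 1 ≤ l)
    (hx : x ∈ X) {g : ℝ} (hgH : g ≤ l * logCap k * smoothShare X K (scale K C))
    (hg : scale K (insert x C) = scale K C →
      energy k l X K (insert x C) ≤ energy k l X K C - g) :
    pendingEnergy k l X K (insert x C) ≤ energy k l X K C - g +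
      if x ∈ shallowPoints X K (scale K C) (1 / (100000 * (l * logCap k))) then
        2 * (l * logCap k) * smoothShare X K (scale K C) else 0 := by
  have hH := one_le_mul_logCap hk hl
  have hS0 := smoothShare_nonneg X K (scale K C)
  have hS1 := smoothShare_le_one X K (scale K C)
  have hHS : 0 ≤ l * logCap k * smoothShare X K (scale K C) := by positivity
  have hif : 0 ≤ if x ∈ shallowPoints X K (scale K C) (1 / (100000 * (l * logCap k))) then
        2 * (l * logCap k) * smoothShare X K (scale K C) else 0 := by
    split_ifs <;> linarith
  by_cases hp : IsPending K (insert x C)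
  swap
  · rw [pendingEnergy, if_neg hp]
    have := le_energy k l X K C
    nlinarith
  rw [pendingEnergy, if_pos hp]
  by_cases hs : scale K (insert x C) = scale K C
  · linarith [hg hs]
  have hD : Metric.infDist (centroid K) (insert x C : Finset (Pt d)) ≤
      Metric.infDist (centroid K) (C : Set (Pt d)) :=
    Metric.infDist_le_infDist_of_subset (by simp) (by exact_mod_cast h.nonempty)
  have hle : scale K (insert x C) ≤ scale K C := Int.log_mono_right hp.infDist_pos hD
  have hlt : scale K (insert x C) < scale K C := lt_of_le_of_ne hle hs
  have hDx : Metric.infDist (centroid K) (insert x C : Finset (Pt d)) = dist x (centroid K) := by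
    refine infDist_insert_eq_of_lt (lt_of_le_of_ne hD fun he => hs ?_)
    rw [scale, scale, he]
  have hscale : scale K (insert x C) = Int.log 4 (dist x (centroid K)) := by rw [scale, hDx]
  have hcr := energy_crossing_le (C := C) (C' := insert x C) (X := X) hk hl
    (smoothShare_antitone X K hle)
  have hanti := smoothShare_antitone X K hle
  by_cases hm : smoothShare X K (scale K (insert x C)) <
      (1 + 1 / (100000 * (l * logCap k))) * smoothShare X K (scale K C)
  · have hmem : x ∈ shallowPoints X K (scale K C) (1 / (100000 * (l * logCap k))) := by
      rw [shallowPoints, Finset.mem_filter]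
      refine ⟨hx, hp.notMem, hDx ▸ hp.infDist_pos, ?_, hscale ▸ hm⟩
      rw [← hDx]
      have h1 := lt_zpow_scale K (insert x C)
      have h2 : (4 : ℝ) ^ (scale K (insert x C) + 1) ≤ 4 ^ scale K C :=
        zpow_le_zpow_right₀ (by norm_num) (by omega)
      rw [zpow_add_one₀ (by norm_num)] at h2
      linarith
    -- The rise is at most `l * logCap k * S`; the same amount again covers the promised drop `g`.
    rw [if_pos hmem]
    have : 0 ≤ 299999 * (l * logCap k) ^ 2 *
        (smoothShare X K (scale K (insert x C)) - smoothShare X K (scale K C)) :=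
      mul_nonneg (by positivity) (by linarith)
    linarith
  -- The growth of `S` pays almost three times `l * logCap k * S`, enough for the rise of the
  -- logarithm and for `g`.
  · push Not at hm
    have h1 : 1 / (100000 * (l * logCap k)) * smoothShare X K (scale K C) ≤
      smoothShare X K (scale K (insert x C)) - smoothShare X K (scale K C) := by linarith
    have h2 := mul_le_mul_of_nonneg_left h1
      (show 0 ≤ 299999 * (l * logCap k) ^ 2 by positivity)
    have h3 : 299999 * (l * logCap k) ^ 2 *
        (1 / (100000 * (l * logCap k)) * smoothShare X K (scale K C)) =
        299999 / 100000 * (l * logCap k * smoothShare X K (scale K C)) := by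
      field_simp
    linarith

end Energy

/-! ### Expected energy change under sampling. -/

section Drift

variable {d k l : ℕ} {X K C : Finset (Pt d)}

/-- The points of the subtype `X` that lie in `s`. -/
def inside (X s : Finset (Pt d)) : Finset X := Finset.univ.filter fun x => (x : Pt d) ∈ s

theorem mem_inside {s : Finset (Pt d)} {x : X} : x ∈ inside X s ↔ (x : Pt d) ∈ s := by
  simp [inside]

theorem sum_inside {s : Finset (Pt d)} (hs : s ⊆ X) (g : Pt d → ℝ) :
    ∑ x ∈ inside X s, g x = ∑ x ∈ s, g x := by
  rw [inside, Finset.sum_filter, Finset.sum_coe_sort X (fun x => if x ∈ s then g x else 0),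
    Finset.sum_ite_mem, Finset.inter_eq_right.2 hs]

/-- The sampling weights of the points of `X`. -/
def weight (X C : Finset (Pt d)) (x : X) : ℝ := pointCost (x : Pt d) C / cost X C

theorem weight_nonneg (C : Finset (Pt d)) (x : X) : 0 ≤ weight X C x :=
  div_nonneg (pointCost_nonneg _ _) (cost_nonneg _ _)

theorem sum_weight (h : cost X C ≠ 0) : ∑ x, weight X C x = 1 := by
  simp only [weight]
  rw [← Finset.sum_div, Finset.sum_coe_sort X (fun x => pointCost x C)]
  exact div_self h

theorem sum_weight_inside {s : Finset (Pt d)} (hs : s ⊆ X) (C : Finset (Pt d)) :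
    ∑ x ∈ inside X s, weight X C x = cost s C / cost X C := by
  simp only [weight]
  rw [← Finset.sum_div, sum_inside hs fun x => pointCost x C]
  rfl

theorem shallowPoints_subset {j : ℤ} {t : ℝ} : shallowPoints X K j t ⊆ X :=
  Finset.filter_subset _ _

theorem IsPending.smoothShare_mul_cost_shallow (h : IsPending K C) {t : ℝ} (ht0 : 0 ≤ t)
    (ht : t ≤ 1 / 2) :
    smoothShare X K (scale K C) * cost (shallowPoints X K (scale K C) t) C ≤
      12 * t * (K.card * Metric.infDist (centroid K) (C : Set (Pt d)) ^ 2) := by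
  set D := Metric.infDist (centroid K) (C : Set (Pt d))
  have h1 : cost (shallowPoints X K (scale K C) t) C ≤
      (shallowPoints X K (scale K C) t).card * (4 * D ^ 2) := by
    rw [← nsmul_eq_mul]
    refine Finset.sum_le_card_nsmul _ _ _ fun x hx => ?_
    simp only [shallowPoints, Finset.mem_filter] at hx
    have h2 : Metric.infDist x (C : Set (Pt d)) ≤ D + dist x (centroid K) :=
      Metric.infDist_le_infDist_add_dist
    have h3 : Metric.infDist x (C : Set (Pt d)) ≤ 2 * D := by
      linarith [h.zpow_scale_le, hx.2.2.2.1]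
    have h4 := pow_le_pow_left₀ Metric.infDist_nonneg h3 2
    unfold pointCost
    linarith
  have h2 := mul_le_mul_of_nonneg_left h1 (smoothShare_nonneg X K (scale K C))
  have h3 := mul_le_mul_of_nonneg_right
    (card_shallowPoints_le (X := X) h.card_pos (scale K C) ht0 ht) (sq_nonneg D)
  linarith

/-- In the union bound over the `l` candidates, the factor `l * logCap k` of the damage cancels
against `t`, and `S` against the bound on the shallow cost. -/
theorem IsPending.mean_shallow_le (h : IsPending K C) (hk : 2 ≤ k) (hl : 1 ≤ l) (hK : K ⊆ X) :
    iidMean (weight X C) (fun c : Fin l → X =>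
      if ∃ j, c j ∈ inside X
        (shallowPoints X K (scale K C) (1 / (100000 * (l * logCap k)))) then (1 : ℝ) else 0) *
      (2 * (l * logCap k) * smoothShare X K (scale K C)) ≤
    24 / 100000 * (l * (K.card * Metric.infDist (centroid K) (C : Set (Pt d)) ^ 2 /
      cost X C)) := by
  have hP : 0 < cost X C := h.cost_pos.trans_le (cost_mono_left hK C)
  have hH := one_le_mul_logCap hk hl
  have ht0 : 0 ≤ 1 / (100000 * (l * logCap k)) := by positivity
  have ht : 1 / (100000 * (l * logCap k)) ≤ 1 / 2 :=
    one_div_le_one_div_of_le (by norm_num) (by linarith)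
  have h1 := iidMean_exists_le (l := l) (weight_nonneg C) (sum_weight hP.ne')
    (inside X (shallowPoints X K (scale K C) (1 / (100000 * (l * logCap k)))))
  rw [sum_weight_inside shallowPoints_subset] at h1
  have h2 := h.smoothShare_mul_cost_shallow (X := X) ht0 ht
  have hS := smoothShare_nonneg X K (scale K C)
  have h3 := mul_le_mul_of_nonneg_right h1
    (show 0 ≤ 2 * (l * logCap k) * smoothShare X K (scale K C) by positivity)
  refine h3.trans ?_
  have h4 := mul_le_mul_of_nonneg_left h2 (show 0 ≤ 2 * l * (l * logCap k) / cost X C by positivity)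
  refine le_trans (le_of_eq ?_) (h4.trans_eq ?_)
  · ring
  · have hL : 0 < logCap k := by linarith [one_le_logCap hk]
    field_simp
    ring

/-- If the selected candidate is shallow, then some candidate is, so the damage is bounded whatever
the selection rule. -/
theorem IsPending.iidMean_pendingEnergy_le (h : IsPending K C) (hk : 2 ≤ k) (hl : 1 ≤ l)
    (hK : K ⊆ X) (sel : (Fin l → X) → Fin l) {g : (Fin l → X) → ℝ}
    (hg : ∀ c, pendingEnergy k l X K (insert (c (sel c) : Pt d) C) ≤
      energy k l X K C - g c +
      if (c (sel c) : Pt d) ∈ shallowPoints X K (scale K C) (1 / (100000 * (l * logCap k))) then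
        2 * (l * logCap k) * smoothShare X K (scale K C) else 0) :
    iidMean (weight X C) (fun c => pendingEnergy k l X K (insert (c (sel c) : Pt d) C)) ≤
      energy k l X K C - iidMean (weight X C) g + 24 / 100000 *
      (l * (K.card * Metric.infDist (centroid K) (C : Set (Pt d)) ^ 2 / cost X C)) := by
  have hP : 0 < cost X C := h.cost_pos.trans_le (cost_mono_left hK C)
  have hH := one_le_mul_logCap hk hl
  have hS := smoothShare_nonneg X K (scale K C)
  have h1 := iidMean_mono (weight_nonneg C) (f := fun c =>
    pendingEnergy k l X K (insert (c (sel c) : Pt d) C)) (g := fun c =>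
      energy k l X K C + ((-1) * g c + (2 * (l * logCap k) * smoothShare X K (scale K C)) *
      if ∃ j, c j ∈ inside X
        (shallowPoints X K (scale K C) (1 / (100000 * (l * logCap k)))) then (1 : ℝ) else 0))
    (fun c => by
      have h2 := hg c
      have h3 : (if (c (sel c) : Pt d) ∈
          shallowPoints X K (scale K C) (1 / (100000 * (l * logCap k))) then
          2 * (l * logCap k) * smoothShare X K (scale K C) else 0) ≤
          (2 * (l * logCap k) * smoothShare X K (scale K C)) *
          if ∃ j, c j ∈ inside X
          (shallowPoints X K (scale K C) (1 / (100000 * (l * logCap k)))) then (1 : ℝ) else 0 := by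
        split_ifs with h4 h5 h5
        · simp
        · exact absurd ⟨sel c, mem_inside.2 h4⟩ h5
        · positivity
        · simp
      linarith)
  rw [iidMean_add, iidMean_add, iidMean_const (sum_weight hP.ne'), iidMean_const_mul,
    iidMean_const_mul] at h1
  linarith [h.mean_shallow_le (X := X) hk hl hK]

theorem half_le_one_sub_pow {q : ℝ} (hq : q ≤ 1) (h : 2 * (l * q) ≤ 1) (hq0 : 0 ≤ q) :
    1 / 2 ≤ (1 - q) ^ (l - 1) := by
  have h1 := one_add_mul_le_pow (show (-2 : ℝ) ≤ -q by linarith) (l - 1)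
  have h2 : ((l - 1 : ℕ) : ℝ) ≤ l := by exact_mod_cast Nat.sub_le l 1
  have h3 := mul_le_mul_of_nonneg_right h2 hq0
  rw [← sub_eq_add_neg 1 q] at h1
  linarith

theorem third_le_one_sub_one_sub_pow {q : ℝ} (hq : q ≤ 1) (h : 1 ≤ 2 * (l * q)) :
    1 / 3 ≤ 1 - (1 - q) ^ l := by
  have h1 : (1 - q) ^ l ≤ Real.exp (-(1 / 2)) := by
    refine (pow_le_pow_left₀ (by linarith) (Real.one_sub_le_exp_neg q) l).trans ?_
    rw [← Real.exp_nat_mul]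
    exact Real.exp_le_exp.2 (by linarith)
  have h2 : Real.exp (-(1 / 2)) ≤ 2 / 3 := by
    rw [Real.exp_neg]
    have h3 := Real.add_one_le_exp (1 / 2 : ℝ)
    rw [inv_le_comm₀ (Real.exp_pos _) (by norm_num)]
    linarith
  linarith

theorem IsPending.iidMean_pendingEnergy_le_of_lt (h : IsPending K C) (hk : 2 ≤ k) (hl : 1 ≤ l)
    (hK : K ⊆ X) (sel : (Fin l → X) → Fin l)
    (hsel : ∀ (c : Fin l → X) (j : Fin l), cost X (insert (c (sel c) : Pt d) C) ≤ cost X (insert (c j : Pt d) C))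
    (hp : cost X C < k * cost K C) :
    iidMean (weight X C) (fun c => pendingEnergy k l X K (insert (c (sel c) : Pt d) C)) ≤
      energy k l X K C - 1 / 500 *
      (l * (K.card * Metric.infDist (centroid K) (C : Set (Pt d)) ^ 2 / cost X C)) := by
  set D := Metric.infDist (centroid K) (C : Set (Pt d)) with hD
  set P := cost X C with hPdef
  set B := nearPoints X K (scale K C - 1) with hB
  set S := smoothShare X K (scale K C) with hS
  have hP : 0 < P := h.cost_pos.trans_le (cost_mono_left hK C)
  have hw := sum_weight hP.ne'
  have hw0 := weight_nonneg (X := X) C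
  have hBX : B ⊆ X := Finset.filter_subset _ _
  set δ : ℝ := 5 / 16 * (B.card * D ^ 2) with hδ
  have hδ0 : 0 ≤ δ := by positivity
  have hu0 : 0 ≤ l * (K.card * D ^ 2 / P) := by positivity
  have hH := one_le_mul_logCap hk hl
  have hS0 : 0 ≤ S := smoothShare_nonneg X K _
  have hS1 : S ≤ 1 := smoothShare_le_one X K _
  have hHS : 0 ≤ l * logCap k * S := by positivity
  have hBP : B.card * (9 / 16 * D ^ 2) ≤ P := by
    rw [← nsmul_eq_mul]
    exact (Finset.card_nsmul_le_sum _ _ _ fun x hx => h.pointCost_near_ge hx).trans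
      (cost_mono_left hBX C)
  have hgH : l * S * (δ / (4 * P)) ≤ l * logCap k * S := by
    have h1 : δ / (4 * P) ≤ 1 := by
      rw [div_le_one (by positivity)]
      linarith
    have h2 : δ / (4 * P) ≤ logCap k := h1.trans (one_le_logCap hk)
    have := mul_le_mul_of_nonneg_left h2 (show 0 ≤ l * S by positivity)
    linarith
  set G : Finset (Pt d) := X.filter fun x => cost X (insert x C) ≤ P - δ with hG
  have hBG : B ⊆ G := fun x hx => Finset.mem_filter.2 ⟨hBX hx, h.cost_insert_near_le hx⟩
  -- Greediness enters here: `G` is a sublevel set of the new cost, so the minimizer lies in it as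
  -- soon as one candidate does.
  have hGsel : ∀ c : Fin l → X, (∃ j, c j ∈ inside X G) → c (sel c) ∈ inside X G := by
    rintro c ⟨j, hj⟩
    rw [mem_inside, hG, Finset.mem_filter] at hj ⊢
    exact ⟨(c (sel c)).2, (hsel c j).trans hj.2⟩
  have hanti : ∀ x, cost X (insert x C) ≤ P := fun x =>
    cost_anti X (Finset.subset_insert x C) h.nonempty
  set q := ∑ x ∈ inside X G, weight X C x with hq
  have hq0 : 0 ≤ q := Finset.sum_nonneg fun x _ => hw0 x
  have hq1 : q ≤ 1 := by
    rw [← hw]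
    exact Finset.sum_le_sum_of_subset_of_nonneg (Finset.subset_univ _) fun x _ _ => hw0 x
  rcases le_total (2 * (l * q)) 1 with hlq | hlq
  · -- a candidate of `K` close to its center of mass is the only competitive one
    have h1 := le_iidMean_unique (l := l) hw0 hw (s := inside X G) (t := inside X (K ∩ B))
      (fun x hx => mem_inside.2 (hBG (Finset.mem_inter.1 (mem_inside.1 hx)).2))
    rw [sum_weight_inside (Finset.inter_subset_left.trans hK)] at h1
    have h2 := h.iidMean_pendingEnergy_le hk hl hK sel (g := fun c =>
      if ∃ j, c j ∈ inside X (K ∩ B) ∧ ∀ i, i ≠ j → c i ∉ inside X G then 1 else 0) (by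
        intro c
        have hstep := h.pendingEnergy_insert_le hk hl (c (sel c)).2 (g := 0) (by linarith)
          (fun hs => by
            rw [sub_zero]
            exact energy_le_of_cost_le hs (hanti _))
        by_cases hc : ∃ j, c j ∈ inside X (K ∩ B) ∧ ∀ i, i ≠ j → c i ∉ inside X G
        · rw [if_pos hc]
          obtain ⟨j, hj, hj'⟩ := hc
          have hjG : c j ∈ inside X G :=
            mem_inside.2 (hBG (Finset.mem_inter.1 (mem_inside.1 hj)).2)
          have hsj : sel c = j := by
            by_contra hne
            exact hj' _ hne (hGsel c ⟨j, hjG⟩)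
          rw [pendingEnergy, if_neg]
          · have := le_energy k l X K C
            refine (show 0 ≤ energy k l X K C - 1 by nlinarith).trans
              (le_add_of_nonneg_right ?_)
            split_ifs <;> linarith
          · intro hp
            rw [hsj] at hp
            exact hp.notMem (Finset.mem_inter.1 (mem_inside.1 hj)).1
        · rw [if_neg hc]
          exact hstep)
    have h3 := half_le_one_sub_pow hq1 hlq hq0
    have h4 : 1 / 2 * (K.card * D ^ 2 / P) ≤ cost (K ∩ B) C / P := by
      rw [← mul_div_assoc]
      refine div_le_div_of_nonneg_right ?_ hP.le
      have h5 : (K ∩ B).card * (9 / 16 * D ^ 2) ≤ cost (K ∩ B) C := by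
        rw [← nsmul_eq_mul]
        exact Finset.card_nsmul_le_sum _ _ _ fun x hx =>
          h.pointCost_near_ge (Finset.mem_inter.1 hx).2
      have h6 := mul_le_mul_of_nonneg_right (h.card_inter_near hK)
        (show 0 ≤ 9 / 16 * D ^ 2 by positivity)
      have h7 : 0 ≤ K.card * D ^ 2 := by positivity
      linarith
    have h5 : l * (1 / 2 * (K.card * D ^ 2 / P)) * (1 / 2) ≤
        l * (cost (K ∩ B) C / P) * (1 - q) ^ (l - 1) :=
      mul_le_mul (mul_le_mul_of_nonneg_left h4 (by positivity)) h3 (by norm_num)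
        (mul_nonneg (by positivity) (div_nonneg (cost_nonneg _ _) hP.le))
    linarith
  -- Here `G` is met with probability at least `1/3`, and each time the cost falls by `δ`.
  · have h1 := iidMean_exists (l := l) hw (inside X G)
    have h2 := h.iidMean_pendingEnergy_le hk hl hK sel (g := fun c =>
      l * S * (δ / (4 * P)) * if ∃ j, c j ∈ inside X G then 1 else 0) (by
        intro c
        by_cases hc : ∃ j, c j ∈ inside X G
        · simp only [if_pos hc, mul_one]
          refine h.pendingEnergy_insert_le hk hl (c (sel c)).2 hgH fun hs => ?_
          have hcG := hGsel c hc
          rw [mem_inside, hG, Finset.mem_filter] at hcG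
          exact h.energy_drop hK hs hp hδ0 hcG.2
        · simp only [if_neg hc, mul_zero]
          refine h.pendingEnergy_insert_le hk hl (c (sel c)).2 hHS fun hs => ?_
          rw [sub_zero]
          exact energy_le_of_cost_le hs (hanti _))
    rw [iidMean_const_mul, h1] at h2
    have h3 := third_le_one_sub_one_sub_pow (l := l) hq1 hlq
    -- `B` lives one scale below `S`; the average still gives that scale a constant weight, and `K ∪
    -- B` has at most `2 |B|` points.
    have h4 : K.card / 8 ≤ S * B.card := by
      have h5 : share X K (scale K C - 1) / 4 ≤ S :=
        quarter_le_geomAverage (share_nonneg X K) (share_le_one X K) (share_antitone X K) _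
      have hN := card_union_pos (X := X) h.card_pos (scale K C - 1)
      have h6 : K.card ≤ 4 * S * (K ∪ nearPoints X K (scale K C - 1)).card := by
        rw [← div_le_iff₀ hN]
        change share X K (scale K C - 1) ≤ _
        linarith
      have h7 := mul_le_mul_of_nonneg_left (h.card_union_near hK) hS0
      rw [← hB] at h6 h7
      linarith
    have h5 : 5 / 512 * (l * (K.card * D ^ 2 / P)) ≤ l * S * (δ / (4 * P)) := by
      have h6 := mul_le_mul_of_nonneg_right h4 (show 0 ≤ 5 / 64 * l * D ^ 2 / P by positivity)
      refine le_trans (le_of_eq (by ring)) (h6.trans_eq ?_)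
      rw [hδ]
      field_simp
      ring
    have h6 := mul_le_mul h5 h3 (by norm_num)
      (mul_nonneg (mul_nonneg (by positivity) hS0) (by positivity))
    linarith

/-- The expected number of candidates in `K` is at most the expected decrease of the energy,
up to a small additive term. -/
theorem IsPending.drift (h : IsPending K C) (hk : 2 ≤ k) (hl : 1 ≤ l)
    (hK : K ⊆ X) (sel : (Fin l → X) → Fin l)
    (hsel : ∀ (c : Fin l → X) (j : Fin l), cost X (insert (c (sel c) : Pt d) C) ≤ cost X (insert (c j : Pt d) C)) :
    iidMean (weight X C) (fun c => (∑ j, if c j ∈ inside X K then 1 else 0) +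
      2000 * pendingEnergy k l X K (insert (c (sel c) : Pt d) C)) ≤
      2000 * energy k l X K C + 4 * (l / k) := by
  have hP : 0 < cost X C := h.cost_pos.trans_le (cost_mono_left hK C)
  have hk0 : (0 : ℝ) < k := by exact_mod_cast (by omega : 0 < k)
  rw [iidMean_add, iidMean_const_mul, iidMean_count (sum_weight hP.ne'), sum_weight_inside hK]
  set u := K.card * Metric.infDist (centroid K) (C : Set (Pt d)) ^ 2 / cost X C with hu
  have h1 : cost K C / cost X C ≤ 21 / 10 * u := by
    rw [hu, ← mul_div_assoc]
    exact div_le_div_of_nonneg_right h.cost_le hP.le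
  have h2 : u ≤ 21 / 10 * (cost K C / cost X C) := by
    rw [hu, ← mul_div_assoc]
    exact div_le_div_of_nonneg_right h.le_cost hP.le
  have h1' := mul_le_mul_of_nonneg_left h1 (Nat.cast_nonneg (α := ℝ) l)
  have h2' := mul_le_mul_of_nonneg_left h2 (Nat.cast_nonneg (α := ℝ) l)
  have hlk : (0 : ℝ) ≤ l / k := by positivity
  have hlu : 0 ≤ l * u := by positivity
  -- Below the threshold, the drop `2000 / 500 * l * u` exceeds the expected hits, at most `21/10 *
  -- l * u`. Above it, hits and shallow damage are both of order `l / k`.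
  rcases lt_or_ge (cost X C) (k * cost K C) with hp | hp
  · have h3 := h.iidMean_pendingEnergy_le_of_lt hk hl hK sel hsel hp
    linarith
  · have h3 := h.iidMean_pendingEnergy_le hk hl hK sel (g := fun _ => 0) fun c =>
      h.pendingEnergy_insert_le hk hl (c (sel c)).2
        (by
          have := one_le_mul_logCap hk hl
          have := smoothShare_nonneg X K (scale K C)
          positivity)
        fun hs => by
          rw [sub_zero]
          exact energy_le_of_cost_le hs (cost_anti X (Finset.subset_insert _ C) h.nonempty)
    rw [iidMean_const (sum_weight hP.ne')] at h3
    have h4 : l * (cost K C / cost X C) ≤ l / k := by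
      rw [div_eq_mul_inv (l : ℝ) (k : ℝ)]
      refine mul_le_mul_of_nonneg_left ?_ (by positivity)
      rw [div_le_iff₀ hP, inv_mul_eq_div, le_div_iff₀ hk0]
      linarith
    linarith

end Drift

/-! ### Summing the drift over the run. -/

section Run

variable {d k l : ℕ} {X K C : Finset (Pt d)}

theorem tsum_bind_mul {α β : Type*} (p : PMF α) (q : α → PMF β) (f : β → ℝ≥0∞) :
    ∑' b, p.bind q b * f b = ∑' a, p a * ∑' b, q a b * f b := by
  simp only [PMF.bind_apply, ← ENNReal.tsum_mul_right, ← ENNReal.tsum_mul_left, mul_assoc]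
  exact ENNReal.tsum_comm

theorem tsum_map_mul {α β : Type*} (p : PMF α) (g : α → β) (f : β → ℝ≥0∞) :
    ∑' b, p.map g b * f b = ∑' a, p a * f (g a) := by
  rw [← PMF.bind_pure_comp, tsum_bind_mul]
  refine tsum_congr fun a => ?_
  congr 1
  rw [tsum_eq_single (g a) fun b hb => by simp [PMF.pure_apply, hb]]
  simp

/-- A bound for the expected number of hits that remain when `C` is the set of centers. -/
def potential (k l : ℕ) (X K C : Finset (Pt d)) : ℝ :=
  if C.Nonempty then 2000 * pendingEnergy k l X K C
  else l + 2000 * (600001 * (l * logCap k) ^ 2)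

theorem pendingEnergy_nonneg (k l : ℕ) (X K C : Finset (Pt d)) :
    0 ≤ pendingEnergy k l X K C := by
  unfold pendingEnergy
  split_ifs
  · exact le_trans (by positivity) (le_energy k l X K C)
  · exact le_rfl

theorem pendingEnergy_le (hk : 2 ≤ k) (hl : 1 ≤ l) (X K C : Finset (Pt d)) :
    pendingEnergy k l X K C ≤ 600001 * (l * logCap k) ^ 2 := by
  unfold pendingEnergy
  split_ifs
  · exact energy_le hk hl X K C
  · positivity

/-- The number of candidates in `K`. -/
def countIn (K : Finset (Pt d)) (c : Fin l → X) : ℕ :=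
  (Finset.univ.filter fun j : Fin l => (c j : Pt d) ∈ K).card

theorem countIn_eq (c : Fin l → X) :
    (countIn K c : ℝ) = ∑ j, if c j ∈ inside X K then (1 : ℝ) else 0 := by
  simp [countIn, mem_inside]

theorem iidLaw_sampleLaw [Nonempty X] (hC : C.Nonempty) (h : cost X C ≠ 0) (c : Fin l → X) :
    iidLaw l (sampleLaw X C) c = ENNReal.ofReal (∏ j, weight X C (c j)) := by
  rw [ENNReal.ofReal_prod_of_nonneg fun j _ => weight_nonneg C (c j)]
  simp [iidLaw, sampleLaw, hC, h, weight]

theorem step_le [Nonempty X] (hk : 2 ≤ k) (hl : 1 ≤ l) (hK : K ⊆ X) (C : Finset (Pt d))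
    (sel : (Fin l → X) → Fin l)
    (hsel : ∀ (c : Fin l → X) (j : Fin l),
      cost X (insert (c (sel c) : Pt d) C) ≤ cost X (insert (c j : Pt d) C)) :
    ∑' c, iidLaw l (sampleLaw X C) c *
      (((if IsCovered K C ∨ IsSolved K C then 0 else countIn K c : ℕ) : ℝ≥0∞) +
        ENNReal.ofReal (potential k l X K (insert (c (sel c) : Pt d) C))) ≤
      ENNReal.ofReal (potential k l X K C + 4 * (l / k)) := by
  have hpot : ∀ x, potential k l X K (insert x C) = 2000 * pendingEnergy k l X K (insert x C) :=
    fun x => if_pos (Finset.insert_nonempty x C)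
  simp only [hpot]
  have hlk : (0 : ℝ) ≤ 4 * (l / k) := by positivity
  -- The first, uniform step is charged trivially: at most `l` hits, followed by at most the maximal
  -- energy.
  rcases C.eq_empty_or_nonempty with hC | hC
  · have hV : potential k l X K C = l + 2000 * (600001 * (l * logCap k) ^ 2) := by
      simp [potential, hC]
    calc _ ≤ ∑' c, iidLaw l (sampleLaw X C) c *
          ENNReal.ofReal (potential k l X K C + 4 * (l / k)) := by
          refine ENNReal.tsum_le_tsum fun c => mul_le_mul_right ?_ _
          rw [← ENNReal.ofReal_natCast, ← ENNReal.ofReal_add (by positivity)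
            (mul_nonneg (by norm_num) (pendingEnergy_nonneg _ _ _ _ _))]
          refine ENNReal.ofReal_le_ofReal ?_
          have h1 := pendingEnergy_le hk hl X K (insert (c (sel c) : Pt d) C)
          have h2 : ((if IsCovered K C ∨ IsSolved K C then 0 else countIn K c : ℕ) : ℝ) ≤ l := by
            have h3 : countIn K c ≤ l := (Finset.card_filter_le _ _).trans (by simp)
            split_ifs
            · simp
            · exact_mod_cast h3
          linarith
      _ = _ := by rw [ENNReal.tsum_mul_right, PMF.tsum_coe, one_mul]
  rw [potential, if_pos hC]
  by_cases hp : IsPending K C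
  · have hP : 0 < cost X C := hp.cost_pos.trans_le (cost_mono_left hK C)
    simp only [if_neg ((isPending_iff hC).1 hp)]
    rw [pendingEnergy, if_pos hp]
    refine le_trans (le_of_eq ?_) (ENNReal.ofReal_le_ofReal (hp.drift hk hl hK sel hsel))
    rw [tsum_fintype, iidMean, ENNReal.ofReal_sum_of_nonneg]
    · refine Finset.sum_congr rfl fun c _ => ?_
      rw [iidLaw_sampleLaw hC hP.ne', ENNReal.ofReal_mul
        (Finset.prod_nonneg fun j _ => weight_nonneg C (c j)), ← countIn_eq,
        ENNReal.ofReal_add (by positivity)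
          (mul_nonneg (by norm_num) (pendingEnergy_nonneg _ _ _ _ _)), ENNReal.ofReal_natCast]
    · intro c _
      refine mul_nonneg (Finset.prod_nonneg fun j _ => weight_nonneg C (c j)) (add_nonneg ?_
        (mul_nonneg (by norm_num) (pendingEnergy_nonneg _ _ _ _ _)))
      rw [← countIn_eq]
      positivity
  · have h1 : IsCovered K C ∨ IsSolved K C := by
      by_contra h
      exact hp ((isPending_iff hC).2 h)
    have h2 : ∀ x, pendingEnergy k l X K (insert x C) = 0 := fun x =>
      if_neg fun h => hp (h.of_insert hC)
    simp [h1, h2]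

/-- Hits so far plus potential form a supermartingale up to an additive `4 * l / k` per step. -/
theorem run_le [Nonempty X] (hk : 2 ≤ k) (hl : 1 ≤ l) (hK : K ⊆ X) {r : Rule X l}
    (hr : IsGreedy r) (n : ℕ) :
    ∑' h, runLaw r n h * ((hits r K h : ℝ≥0∞) +
      ENNReal.ofReal (potential k l X K (centers r h))) ≤
      ENNReal.ofReal (potential k l X K ∅ + n * (4 * (l / k))) := by
  have hlk : (0 : ℝ) ≤ 4 * (l / k) := by positivity
  induction n with
  | zero => simp [runLaw, hits, centers]
  | succ n ih =>
    rw [runLaw, tsum_bind_mul]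
    have hV : ∀ C : Finset (Pt d), 0 ≤ potential k l X K C := by
      intro C
      unfold potential
      split_ifs
      · exact mul_nonneg (by norm_num) (pendingEnergy_nonneg _ _ _ _ _)
      · positivity
    calc _ ≤ ∑' h, runLaw r n h * (((hits r K h : ℝ≥0∞) +
          ENNReal.ofReal (potential k l X K (centers r h))) +
          ENNReal.ofReal (4 * (l / k))) := by
          refine ENNReal.tsum_le_tsum fun h => mul_le_mul_right ?_ _
          rw [tsum_map_mul]
          have h1 := step_le hk hl hK (centers r h) (r h) (hr h)
          rw [ENNReal.ofReal_add (hV _) hlk] at h1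
          rw [add_assoc]
          refine le_trans (le_of_eq ?_) (add_le_add_right h1 _)
          simp only [hits, centers, Nat.cast_add, add_assoc]
          simp only [mul_add, ENNReal.tsum_add]
          rw [ENNReal.tsum_mul_right, PMF.tsum_coe, one_mul]
          rfl
      _ ≤ ENNReal.ofReal (potential k l X K ∅ + n * (4 * (l / k))) +
          ENNReal.ofReal (4 * (l / k)) := by
          simp only [mul_add _ _ (ENNReal.ofReal (4 * (l / k)))]
          rw [ENNReal.tsum_add, ENNReal.tsum_mul_right, PMF.tsum_coe, one_mul]
          exact add_le_add_left ih _
      _ = _ := by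
          rw [← ENNReal.ofReal_add (add_nonneg (hV _) (by positivity)) hlk]
          congr 1
          push_cast
          ring

theorem IsOptimalCluster.subset (h : IsOptimalCluster X k K) : K ⊆ X := by
  obtain ⟨C, _, a, _, c, _, rfl⟩ := h
  exact Finset.filter_subset _ _

theorem expectation_hits_le [Nonempty X] (hk : 2 ≤ k) (hl : 1 ≤ l) (hK : K ⊆ X)
    {r : Rule X l} (hr : IsGreedy r) :
    expectation (runLaw r k) (hits r K) ≤
      ENNReal.ofReal (150000000000 * (l : ℝ) ^ 2 * Real.log (k : ℝ) ^ 2) := by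
  refine le_trans (ENNReal.tsum_le_tsum fun h => mul_le_mul_right le_self_add _)
    ((run_le hk hl hK hr k).trans (ENNReal.ofReal_le_ofReal ?_))
  have hk0 : (k : ℝ) ≠ 0 := by exact_mod_cast (by omega : k ≠ 0)
  have hl1 : (1 : ℝ) ≤ l := by exact_mod_cast hl
  have h1 := one_le_logCap hk
  have h2 := logCap_le hk
  have h3 : l ≤ (l * logCap k) ^ 2 := by
    have h5 : l ≤ l * logCap k := le_mul_of_one_le_right (by positivity) h1
    nlinarith
  have h4 : (l * logCap k) ^ 2 ≤ 121 * ((l : ℝ) ^ 2 * Real.log k ^ 2) := by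
    have h5 : l * logCap k ≤ l * (11 * Real.log k) :=
      mul_le_mul_of_nonneg_left h2 (by positivity)
    have h6 := pow_le_pow_left₀ (by positivity) h5 2
    linarith
  -- Over `k` steps the additive errors total `4 * l`, dominated by the initial potential.
  have h7 : (k : ℝ) * (4 * (l / k)) = 4 * l := by field_simp
  rw [h7]
  simp only [potential, Finset.not_nonempty_empty, if_false]
  linarith [show (0 : ℝ) ≤ (l : ℝ) ^ 2 * Real.log k ^ 2 by positivity]

end Run

end

end GreedyKMeans

theorem mainTheorem2 :
    ∃ A : ℝ, 0 < A ∧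
      ∀ (d k l : ℕ), 2 ≤ k → 1 ≤ l →
        ∀ (X : Finset (GreedyKMeans.Pt d)) [Nonempty X] (r : GreedyKMeans.Rule X l),
          GreedyKMeans.IsGreedy r →
          ∀ K : Finset (GreedyKMeans.Pt d), GreedyKMeans.IsOptimalCluster X k K →
            GreedyKMeans.expectation (GreedyKMeans.runLaw r k) (GreedyKMeans.hits r K) ≤
              ENNReal.ofReal (A * (l : ℝ) ^ 2 * Real.log (k : ℝ) ^ 2) := by
  exact ⟨150000000000, by norm_num, fun _ _ _ hk hl _ _ _ hr _ hK =>
    GreedyKMeans.expectation_hits_le hk hl hK.subset hr⟩
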